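/- Let $\alpha>0$, $c_\alpha>0$ and $q_0>0$ with $q_0\neq1$, and consider the generalized isotonic potential $$U(q)=\frac{c_\alpha}{8}\Big(|q|^{\frac{\alpha+1}{2}}-\frac{1}{|q|^{\frac{\alpha+1}{2}}}\Big)^2 ,$$ whose equation of motion $\ddot q=-U'(q)$ on $0<q<\infty$ is $$\ddot q+\frac{c_\alpha}{8}(\alpha+1)q^{\alpha}=\frac{c_\alpha(\alpha+1)}{8q^{\alpha+2}},\qquad q(0)=q_0,\quad \dot q(0)=0 .$$ This initial value problem has a unique solution $q:\mathbb R\to(0,\infty)$, and it is periodic with a minimal period $T>0$. Put $$\tilde U(\xi)=\frac{c_\alpha}{8}\Big(\big(\sqrt{\xi^2+1}+\xi\big)^{\frac{\alpha+1}{2}}-\big(\sqrt{\xi^2+1}+\xi\big)^{-\frac{\alpha+1}{2}}\Big)^2,\qquad \xi_0=\frac12\Big(q_0-\frac1{q_0}\Big),\qquad k_\alpha=\sqrt{\frac{2\tilde U(\xi_0)}{c_\alpha}} .$$ If $k_\alpha<1$ or $\alpha=1$, then $$T=\frac{4}{\sqrt{c_\alpha}(\alpha+1)}\sum_{m=0}^{\infty}\sum_{n=0}^{\infty}\binom{\frac{2}{\alpha+1}}{2m}\binom{\frac{1}{\alpha+1}-\frac12-m}{n}k_\alpha^{2(m+n)}B\big(m+n+\tfrac12,\tfrac12\big),$$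 where $B$ is the Euler Beta function and the series, summed first over $n$ and then over $m$, converges (each of the two successive sums absolutely). If $k_\alpha\ge1$ and $\alpha\ne1$, the inner sum over $n$ diverges for some $m$, so the formula is valid exactly when its right-hand side makes sense. For $\alpha=1$ and every $q_0$ the period is $T=2\pi/\sqrt{c_\alpha}$; in particular it is the isochronous value $2\pi$ when $c_\alpha=1$. -/

import Mathlib

noncomputable section

/-- The generalized isotonic potential `U(q)`. -/
def isotonicPotential (c α q : ℝ) : ℝ :=
  c / 8 * (|q| ^ ((α + 1) / 2) - 1 / |q| ^ ((α + 1) / 2)) ^ 2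

/-- `q : ℝ → ℝ` is the motion on the half line `q > 0` that starts at rest from `q₀`:
`q'' + (c / 8) (α + 1) q ^ α = c (α + 1) / (8 q ^ (α + 2))`, `q 0 = q₀`, `q' 0 = 0`. -/
structure IsIsotonicMotion (c α q₀ : ℝ) (q : ℝ → ℝ) : Prop where
  pos : ∀ t, 0 < q t
  differentiable : Differentiable ℝ q
  differentiable_deriv : Differentiable ℝ (deriv q)
  equation : ∀ t, deriv (deriv q) t + c / 8 * (α + 1) * q t ^ α
    = c * (α + 1) / (8 * q t ^ (α + 2))
  initial_position : q 0 = q₀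
  initial_velocity : deriv q 0 = 0

/-- `T` is the (minimal positive) period of `q`. -/
def IsMinimalPeriod (q : ℝ → ℝ) (T : ℝ) : Prop :=
  IsLeast {S : ℝ | 0 < S ∧ Function.Periodic q S} T

/-- The involution `σ` of the half line `q > 0` exchanging the two points of the same
potential energy on the two sides of the minimum `q = 1`. -/
def isotonicInvolution (q : ℝ) : ℝ := 1 / q

/-- The coordinate `ξ = h(q) = (q - σ(q)) / 2` that makes the potential symmetric. -/
def symmetrizingCoordinate (q : ℝ) : ℝ := (q - isotonicInvolution q) / 2

/-- The symmetrized potential `Ũ(ξ)`, which is determined by `Ũ(h(q)) = U(q)`. -/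
def symmetrizedPotential (c α ξ : ℝ) : ℝ :=
  c / 8 * ((√(ξ ^ 2 + 1) + ξ) ^ ((α + 1) / 2)
    - 1 / (√(ξ ^ 2 + 1) + ξ) ^ ((α + 1) / 2)) ^ 2

/-- The amplitude parameter `k = √(2 Ũ(ξ₀) / c)`, where `ξ₀ = h(q₀)`. -/
def amplitudeParameter (c α q₀ : ℝ) : ℝ :=
  √(2 * symmetrizedPotential c α (symmetrizingCoordinate q₀) / c)

/-- The `(m, n)` term of the double series for the period. -/
def periodTerm (α k : ℝ) (m n : ℕ) : ℝ :=
  Ring.choose (2 / (α + 1)) (2 * m) * Ring.choose (1 / (α + 1) - 1 / 2 - (m : ℝ)) n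
    * k ^ (2 * (m + n)) * ProbabilityTheory.beta ((m : ℝ) + n + 1 / 2) (1 / 2)

theorem isotonicPotential_involution (c α : ℝ) {q : ℝ} (hq : 0 < q) :
    isotonicPotential c α (isotonicInvolution q) = isotonicPotential c α q := by
  have h : |(1 / q)| ^ ((α + 1) / 2) = 1 / |q| ^ ((α + 1) / 2) := by
    rw [abs_of_pos hq, abs_of_pos (by positivity), Real.div_rpow zero_le_one hq.le,
      Real.one_rpow]
  simp only [isotonicPotential, isotonicInvolution, h, one_div_one_div]
  ring

theorem symmetrizedPotential_coordinate (c α : ℝ) {q : ℝ} (hq : 0 < q) :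
    symmetrizedPotential c α (symmetrizingCoordinate q) = isotonicPotential c α q := by
  have h1 : symmetrizingCoordinate q ^ 2 + 1 = ((q + 1 / q) / 2) ^ 2 := by
    simp only [symmetrizingCoordinate, isotonicInvolution]
    field_simp
    ring
  have h2 : √(symmetrizingCoordinate q ^ 2 + 1) + symmetrizingCoordinate q = q := by
    rw [h1, Real.sqrt_sq (by positivity)]
    simp only [symmetrizingCoordinate, isotonicInvolution]
    ring
  simp only [symmetrizedPotential, isotonicPotential, h2, abs_of_pos hq]

end

open Real Set Filter Topology

/-! With `β = 2 / (α + 1)`, put `sinh (log q / β) = κ cos θ`, where `κ` is the value at `q₀` and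
`|κ|` is the amplitude parameter. The potential becomes `c κ² cos² θ / 2`, so energy conservation
reads `q' = -√c κ sin θ`, and time advances by `2 / (√c (α + 1)) * phaseDensity β κ θ` per unit of
phase. Inverting this time function gives the motion, and its period is the integral over one turn
(`exists_isotonicMotion`); energy confinement gives uniqueness.

With `x = κ cos θ`, the density is `(x + √(1 + x²)) ^ β / √(1 + x²)`. Its even part expands
binomially in `x / √(1 + x²)`, for every `κ` (`hasSum_integral_phaseDensity`). Expanding the
remaining powers of `1 + x²` in `x²` needs `|κ| < 1` (`hasSum_periodMoment`), and the cosine moments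
are Beta values. For `α = 1` both binomial series reduce to one term. Otherwise, if `|κ| ≥ 1`, the
inner terms for `m = 3` do not tend to zero. -/

/-- A continuous positive periodic density `f` is the reciprocal speed of a flow `φ` on the line
which advances by one period of `f` in the time `∫ f`. -/
theorem exists_flow_of_periodic_density {f : ℝ → ℝ} {P : ℝ} (hf : Continuous f)
    (hpos : ∀ x, 0 < f x) (hper : Function.Periodic f P) (hP : 0 < P) :
    ∃ φ : ℝ → ℝ, φ 0 = 0 ∧ StrictMono φ ∧ (∀ t, HasDerivAt φ (f (φ t))⁻¹ t) ∧
      ∀ t, φ (t + ∫ x in (0 : ℝ)..P, f x) = φ t + P := by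
  set G : ℝ → ℝ := fun θ => ∫ x in (0 : ℝ)..θ, f x with hG
  have hderiv : ∀ θ, HasDerivAt G (f θ) θ := fun θ =>
    intervalIntegral.integral_hasDerivAt_right (hf.intervalIntegrable _ _)
      hf.aestronglyMeasurable.stronglyMeasurableAtFilter hf.continuousAt
  have hcont : Continuous G := continuous_iff_continuousAt.2 fun θ => (hderiv θ).continuousAt
  have hmono : StrictMono G := strictMono_of_deriv_pos fun θ => by
    rw [(hderiv θ).deriv]; exact hpos θ
  have hsurj : Function.Surjective G := hcont.surjective
    (hper.tendsto_atTop_intervalIntegral_of_pos' (hf.intervalIntegrable _ _) hpos hP)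
    (hper.tendsto_atBot_intervalIntegral_of_pos' (hf.intervalIntegrable _ _) hpos hP)
  set e : ℝ ≃o ℝ := hmono.orderIsoOfSurjective G hsurj with he
  have hGe : ∀ t, G (e.symm t) = t := fun t => e.apply_symm_apply t
  refine ⟨e.symm, hmono.injective ?_, e.symm.strictMono, fun t => ?_, fun t => hmono.injective ?_⟩
  · rw [hGe]; simp [hG]
  · exact HasDerivAt.of_local_left_inverse e.symm.continuous.continuousAt (hderiv _)
      (hpos _).ne' (Eventually.of_forall hGe)
  · rw [hGe]
    have := hper.intervalIntegral_add_eq_add 0 (e.symm t) fun _ _ => hf.intervalIntegrable _ _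
    simp only [zero_add] at this
    change _ = ∫ x in (0 : ℝ)..(e.symm t + P), f x
    rw [this]
    exact congrArg (· + _) (hGe t).symm

/-! ### The potential and its force, as rational expressions in `q` and `q ^ ((α + 1) / 2)`. -/

theorem rpow_eq_sq_rpow_half_div {q : ℝ} (hq : 0 < q) (α : ℝ) :
    q ^ α = (q ^ ((α + 1) / 2)) ^ 2 / q := by
  rw [← rpow_natCast, ← rpow_mul hq.le, show (α + 1) / 2 * (2 : ℕ) = α + 1 by push_cast; ring,
    rpow_add hq, rpow_one]
  field_simp

theorem rpow_add_two_eq_sq_rpow_half_mul {q : ℝ} (hq : 0 < q) (α : ℝ) :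
    q ^ (α + 2) = (q ^ ((α + 1) / 2)) ^ 2 * q := by
  rw [← rpow_natCast, ← rpow_mul hq.le, show (α + 1) / 2 * (2 : ℕ) = α + 1 by push_cast; ring,
    ← rpow_add_one hq.ne']
  ring_nf

theorem hasDerivAt_isotonicPotential (c α : ℝ) {q : ℝ} (hq : 0 < q) :
    HasDerivAt (isotonicPotential c α)
      (c / 8 * (α + 1) * q ^ α - c * (α + 1) / (8 * q ^ (α + 2))) q := by
  have hy : (0 : ℝ) < q ^ ((α + 1) / 2) := rpow_pos_of_pos hq _
  have hd : HasDerivAt (fun x : ℝ => x ^ ((α + 1) / 2))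
      ((α + 1) / 2 * q ^ ((α + 1) / 2 - 1)) q := hasDerivAt_rpow_const (Or.inl hq.ne')
  have h := ((hd.sub (hd.inv hy.ne')).pow 2).const_mul (c / 8)
  have h1 : q ^ ((α + 1) / 2 - 1) = q ^ ((α + 1) / 2) / q := by
    rw [rpow_sub hq, rpow_one]
  rw [rpow_eq_sq_rpow_half_div hq, rpow_add_two_eq_sq_rpow_half_mul hq]
  refine (h.congr_deriv ?_).congr_of_eventuallyEq ?_
  · simp only [h1, Pi.sub_apply, Pi.inv_apply, Nat.reduceSub, pow_one, Nat.cast_ofNat]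
    generalize q ^ ((α + 1) / 2) = y at hy
    field_simp
    ring
  · filter_upwards [lt_mem_nhds hq] with x hx
    simp [isotonicPotential, abs_of_pos hx]

/-! ### Phase parametrisation and existence of the motion. -/

/-- The position at the phase `θ` of the motion with signed amplitude `κ`, for `β = 2 / (α + 1)`. -/
noncomputable def phasePosition (β κ θ : ℝ) : ℝ := exp (β * arsinh (κ * cos θ))

/-- The time that the motion spends per unit of phase, up to a constant factor. -/
noncomputable def phaseDensity (β κ θ : ℝ) : ℝ := phasePosition β κ θ / √(1 + (κ * cos θ) ^ 2)

theorem phasePosition_pos (β κ θ : ℝ) : 0 < phasePosition β κ θ := exp_pos _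

theorem continuous_phasePosition (β κ : ℝ) : Continuous (phasePosition β κ) :=
  continuous_exp.comp (continuous_const.mul
    (continuous_arsinh.comp (continuous_const.mul continuous_cos)))

theorem phaseDensity_pos (β κ θ : ℝ) : 0 < phaseDensity β κ θ :=
  div_pos (phasePosition_pos _ _ _) (by positivity)

theorem continuous_phaseDensity (β κ : ℝ) : Continuous (phaseDensity β κ) :=
  (continuous_phasePosition β κ).div (by fun_prop) fun θ => by positivity

theorem hasDerivAt_phasePosition (β κ θ : ℝ) :
    HasDerivAt (phasePosition β κ) (-(β * κ * sin θ * phaseDensity β κ θ)) θ := by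
  have h := ((((hasDerivAt_cos θ).const_mul κ).arsinh).const_mul β).exp
  refine h.congr_deriv ?_
  simp only [phaseDensity, phasePosition, smul_eq_mul]
  field_simp

theorem phasePosition_rpow {α β : ℝ} (hβ : β * ((α + 1) / 2) = 1) (κ θ : ℝ) :
    phasePosition β κ θ ^ ((α + 1) / 2) = κ * cos θ + √(1 + (κ * cos θ) ^ 2) := by
  rw [phasePosition, ← exp_mul, mul_right_comm, hβ, one_mul, exp_arsinh]

/-- The force at the phase `θ`. -/
theorem isotonic_force_phasePosition {α β : ℝ} (hβ : β * ((α + 1) / 2) = 1) (c κ θ : ℝ) :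
    c / 8 * (α + 1) * phasePosition β κ θ ^ α
      - c * (α + 1) / (8 * phasePosition β κ θ ^ (α + 2))
      = c * ((α + 1) / 2) * (κ * cos θ) * (phaseDensity β κ θ)⁻¹ := by
  set q := phasePosition β κ θ with hqdef
  have hq : 0 < q := phasePosition_pos _ _ _
  have hy := phasePosition_rpow hβ κ θ
  rw [← hqdef] at hy
  set x := κ * cos θ with hx
  have hS : √(1 + x ^ 2) ^ 2 = 1 + x ^ 2 := sq_sqrt (by positivity)
  have hDe : phaseDensity β κ θ = q / √(1 + x ^ 2) := rfl
  rw [hDe, inv_div]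
  set S := √(1 + x ^ 2) with hSdef
  have hypos : 0 < x + S := hy ▸ rpow_pos_of_pos hq _
  have h2 : q ^ α = (x + S) ^ 2 / q := hy ▸ rpow_eq_sq_rpow_half_div hq α
  have h3 : q ^ (α + 2) = (x + S) ^ 2 * q := hy ▸ rpow_add_two_eq_sq_rpow_half_mul hq α
  have hinv : (x + S)⁻¹ = S - x := inv_eq_of_mul_eq_one_right (by nlinarith)
  have h4 : c * (α + 1) / (8 * ((x + S) ^ 2 * q)) = c * (α + 1) / (8 * q) * (S - x) ^ 2 := by
    rw [← hinv]; field_simp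
  rw [h2, h3, h4]
  field_simp
  ring

/-- Existence of the motion, together with its period. -/
theorem exists_isotonicMotion {α c q₀ : ℝ} (hα : 0 < α) (hc : 0 < c) (hq₀ : 0 < q₀)
    (hne : q₀ ≠ 1) :
    ∃ q, IsIsotonicMotion c α q₀ q ∧ IsMinimalPeriod q (∫ θ in (0 : ℝ)..(2 * π),
      2 / (√c * (α + 1)) * phaseDensity (2 / (α + 1)) (sinh ((α + 1) / 2 * log q₀)) θ) := by
  set κ := sinh ((α + 1) / 2 * log q₀) with hκ
  set β := 2 / (α + 1) with hβdef
  have hβ : β * ((α + 1) / 2) = 1 := by rw [hβdef]; field_simp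
  have hβpos : 0 < β := by positivity
  have hl : 0 < 2 / (√c * (α + 1)) := by positivity
  have hκ0 : κ ≠ 0 := by
    rw [hκ, Ne, sinh_eq_zero]
    exact mul_ne_zero (by positivity) (log_ne_zero_of_pos_of_ne_one hq₀ hne)
  set f : ℝ → ℝ := fun θ => 2 / (√c * (α + 1)) * phaseDensity β κ θ with hf
  have hfpos : ∀ θ, 0 < f θ := fun θ => mul_pos hl (phaseDensity_pos _ _ _)
  have hfper : Function.Periodic f (2 * π) := fun θ => by
    simp only [hf, phaseDensity, phasePosition, cos_add_two_pi]
  have hfc : Continuous f := continuous_const.mul (continuous_phaseDensity β κ)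
  obtain ⟨φ, hφ0, hφm, hφd, hφT⟩ := exists_flow_of_periodic_density hfc hfpos hfper two_pi_pos
  have hQ0 : phasePosition β κ 0 = q₀ := by
    rw [phasePosition, cos_zero, mul_one, hκ, arsinh_sinh, ← mul_assoc, hβ, one_mul, exp_log hq₀]
  have hd1 : ∀ t, HasDerivAt (fun t => phasePosition β κ (φ t)) (-(√c * κ * sin (φ t))) t := by
    intro t
    refine ((hasDerivAt_phasePosition β κ (φ t)).comp t (hφd t)).congr_deriv ?_
    have := phaseDensity_pos β κ (φ t)
    simp only [hf, hβdef] at this ⊢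
    field_simp
  have hd1' : deriv (fun t => phasePosition β κ (φ t)) = fun t => -(√c * κ * sin (φ t)) :=
    funext fun t => (hd1 t).deriv
  have hd2 : ∀ t, HasDerivAt (fun t => -(√c * κ * sin (φ t)))
      (-(c * ((α + 1) / 2) * (κ * cos (φ t)) * (phaseDensity β κ (φ t))⁻¹)) t := by
    intro t
    refine (((hasDerivAt_sin (φ t)).comp t (hφd t)).const_mul (√c * κ)).neg.congr_deriv ?_
    have := phaseDensity_pos β κ (φ t)
    have hcs : c = √c * √c := (mul_self_sqrt hc.le).symm
    simp only [hf] at this ⊢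
    rw [congrArg (fun z => -(z * ((α + 1) / 2) * (κ * cos (φ t)) *
      (phaseDensity β κ (φ t))⁻¹)) hcs]
    field_simp
  refine ⟨fun t => phasePosition β κ (φ t), ⟨fun t => phasePosition_pos _ _ _,
    fun t => (hd1 t).differentiableAt, ?_, fun t => ?_, ?_, ?_⟩, ⟨?_, ?_⟩, ?_⟩
  · rw [hd1']; exact fun t => (hd2 t).differentiableAt
  · rw [hd1', (hd2 t).deriv, ← isotonic_force_phasePosition hβ]
    ring
  · simp only [hφ0, hQ0]
  · rw [hd1']; simp [hφ0]
  · exact intervalIntegral.intervalIntegral_pos_of_pos (hfc.intervalIntegrable _ _) hfpos two_pi_pos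
  · intro t
    simp only [hφT, phasePosition, cos_add_two_pi]
  · rintro S ⟨hS, hSp⟩
    -- A shorter period `S` has phase strictly between `0` and `2π`, yet returning to `q₀` forces
    -- `cos (φ S) = 1`.
    by_contra! hlt
    have h1 : 0 < φ S := hφ0 ▸ hφm hS
    have h2 : φ S < 2 * π := by
      have := hφT 0
      rw [zero_add, hφ0, zero_add] at this
      exact this ▸ hφm hlt
    have h3 := hSp 0
    simp only [zero_add, hφ0, phasePosition, exp_eq_exp, mul_right_inj' hβpos.ne', arsinh_inj,
      mul_right_inj' hκ0, cos_zero] at h3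
    exact h1.ne' ((cos_eq_one_iff_of_lt_of_lt (by linarith) h2).1 h3)

/-! ### Energy confinement and uniqueness. -/

/-- A motion with bounded energy stays in a compact part of the half line. -/
theorem isotonicPotential_sublevel {c α E : ℝ} (hc : 0 < c) (hα : 0 < α) :
    ∃ a b : ℝ, 0 < a ∧ ∀ q, 0 < q → isotonicPotential c α q ≤ E → q ∈ Icc a b := by
  -- For `y = q ^ ((α + 1) / 2)` the energy bounds `|y - 1 / y|` by `√(8 E / c)`; as one of `y`, `1
  -- / y` is at most `1`, both are at most `R`.
  set R := √(8 * E / c) + 1 with hR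
  have hR1 : 1 ≤ R := by simp [hR]
  have ha : 0 < (α + 1) / 2 := by positivity
  refine ⟨(R⁻¹) ^ ((α + 1) / 2)⁻¹, R ^ ((α + 1) / 2)⁻¹, by positivity, fun q hq hE => ?_⟩
  set y := q ^ ((α + 1) / 2) with hy
  have hy0 : 0 < y := rpow_pos_of_pos hq _
  have hqy : q = y ^ ((α + 1) / 2)⁻¹ := by rw [hy, rpow_rpow_inv hq.le ha.ne']
  have hsq : (y - 1 / y) ^ 2 ≤ 8 * E / c := by
    rw [isotonicPotential, abs_of_pos hq, ← hy] at hE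
    rw [le_div_iff₀ hc]; linarith
  have habs := abs_le.1 (abs_le_sqrt hsq)
  have hyR : y ≤ R := by
    rcases le_total y 1 with h | h
    · exact h.trans hR1
    · have : 1 / y ≤ 1 := (div_le_one hy0).2 h
      linarith [habs.2]
  have hyR' : R⁻¹ ≤ y := by
    rw [inv_le_comm₀ (by positivity) hy0, ← one_div]
    rcases le_total y 1 with h | h
    · linarith [habs.1]
    · exact ((div_le_one hy0).2 h).trans hR1
  rw [hqy]
  exact ⟨rpow_le_rpow (by positivity) hyR' (by positivity), rpow_le_rpow hy0.le hyR (by positivity)⟩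

namespace IsIsotonicMotion

variable {c α q₀ : ℝ} {q : ℝ → ℝ}

theorem hasDerivAt_deriv (h : IsIsotonicMotion c α q₀ q) (t : ℝ) : HasDerivAt (deriv q)
    (-(c / 8 * (α + 1) * q t ^ α - c * (α + 1) / (8 * q t ^ (α + 2)))) t :=
  (h.differentiable_deriv t).hasDerivAt.congr_deriv (by linarith [h.equation t])

theorem energy (h : IsIsotonicMotion c α q₀ q) (t : ℝ) :
    deriv q t ^ 2 / 2 + isotonicPotential c α (q t) = isotonicPotential c α q₀ := by
  have hd : ∀ t, HasDerivAt (fun t => deriv q t ^ 2 / 2 + isotonicPotential c α (q t)) 0 t := by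
    intro t
    refine ((((h.hasDerivAt_deriv t).pow 2).div_const 2).add
      ((hasDerivAt_isotonicPotential c α (h.pos t)).comp t
        (h.differentiable t).hasDerivAt)).congr_deriv ?_
    push_cast
    ring
  have := is_const_of_deriv_eq_zero (fun t => (hd t).differentiableAt) (fun t => (hd t).deriv) t 0
  simpa [h.initial_position, h.initial_velocity] using this

/-- The force is singular at `q = 0`, but energy keeps both motions in a common compact interval of
positive numbers, where the first-order system for `(q, q')` is Lipschitz. -/
theorem unique {p : ℝ → ℝ} (hα : 0 < α) (hc : 0 < c) (hp : IsIsotonicMotion c α q₀ p)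
    (hq : IsIsotonicMotion c α q₀ q) : p = q := by
  obtain ⟨a, b, ha, hab⟩ := isotonicPotential_sublevel (E := isotonicPotential c α q₀) hc hα
  have hmem : ∀ {r : ℝ → ℝ}, IsIsotonicMotion c α q₀ r → ∀ t, r t ∈ Icc a b := fun {r} hr t =>
    hab _ (hr.pos t) (by linarith [hr.energy t, sq_nonneg (deriv r t)])
  set F : ℝ → ℝ := fun x => -(c / 8 * (α + 1) * x ^ α - c * (α + 1) / (8 * x ^ (α + 2))) with hF
  obtain ⟨K, hK⟩ : ∃ K, LipschitzOnWith K F (Icc a b) := by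
    refine ContDiffOn.exists_lipschitzOnWith (n := 1) ?_ one_ne_zero (convex_Icc a b) isCompact_Icc
    intro x hx
    have hx0 : 0 < x := ha.trans_le hx.1
    have h1 : ∀ s : ℝ, ContDiffAt ℝ 1 (fun x : ℝ => x ^ s) x := fun s =>
      contDiffAt_rpow_const_of_ne hx0.ne'
    exact ((contDiffAt_const.mul (h1 α)).sub (contDiffAt_const.div (contDiffAt_const.mul
      (h1 (α + 2))) (by positivity))).neg.contDiffWithinAt
  have hv : LipschitzOnWith (max 1 K) (fun z : ℝ × ℝ => (z.2, F z.1)) (Icc a b ×ˢ univ) := by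
    have h2 : LipschitzOnWith (K * 1) (F ∘ Prod.fst) (Icc a b ×ˢ (univ : Set ℝ)) :=
      hK.comp (LipschitzWith.prod_fst.lipschitzOnWith) fun z hz => hz.1
    rw [mul_one] at h2
    exact (LipschitzWith.prod_snd.lipschitzOnWith).prodMk h2
  have hsol : ∀ {r : ℝ → ℝ}, IsIsotonicMotion c α q₀ r → ∀ t,
      HasDerivAt (fun t => (r t, deriv r t)) (deriv r t, F (r t)) t ∧
        (r t, deriv r t) ∈ Icc a b ×ˢ (univ : Set ℝ) := fun hr t =>
    ⟨(hr.differentiable t).hasDerivAt.prodMk (hr.hasDerivAt_deriv t), hmem hr t, mem_univ _⟩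
  have := ODE_solution_unique_univ (t₀ := 0) (v := fun _ z => (z.2, F z.1))
    (s := fun _ => Icc a b ×ˢ univ) (fun _ => hv) (hsol hp) (hsol hq)
    (by rw [hp.initial_position, hq.initial_position, hp.initial_velocity, hq.initial_velocity])
  exact funext fun t => congrArg Prod.fst (congrFun this t)

end IsIsotonicMotion

/-! ### Binomial coefficients and binomial series. -/

theorem Ring.choose_succ_mul {K : Type*} [Field K] [CharZero K] (a : K) (n : ℕ) :
    Ring.choose a (n + 1) * (n + 1) = Ring.choose a n * (a - n) := by
  have hn : ((n : K) + 1) ≠ 0 := by exact_mod_cast n.succ_ne_zero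
  have hf : (n.factorial : K) ≠ 0 := by exact_mod_cast n.factorial_ne_zero
  simp only [Ring.choose_eq_smul, descPochhammer_succ_right, Polynomial.smeval_mul,
    Polynomial.smeval_sub, Polynomial.smeval_X, Polynomial.smeval_natCast, pow_one, pow_zero,
    Nat.factorial_succ, smul_eq_mul]
  push_cast
  simp
  field_simp

theorem Ring.choose_ne_zero_of_forall_ne {K : Type*} [Field K] [CharZero K] {a : K}
    (ha : ∀ n : ℕ, a ≠ n) (n : ℕ) : Ring.choose a n ≠ 0 := by
  induction n with
  | zero => simp
  | succ n ih =>
    intro h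
    have := Ring.choose_succ_mul a n
    rw [h, zero_mul] at this
    exact mul_ne_zero ih (sub_ne_zero.2 (ha n)) this.symm

/-- Consecutive coefficients have ratio `|a - n| / (n + 1) ≥ (n + 2) / (n + 1)`, and the product
telescopes. -/
theorem le_abs_ring_choose {a : ℝ} (ha : a ≤ -2) (n : ℕ) : (n : ℝ) + 1 ≤ |Ring.choose a n| := by
  induction n with
  | zero => simp
  | succ n ih =>
    have h := congrArg abs (Ring.choose_succ_mul a n)
    have hn : (0 : ℝ) ≤ n := n.cast_nonneg
    rw [abs_mul, abs_mul, abs_of_pos (by positivity : (0 : ℝ) < n + 1),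
      abs_of_neg (by linarith : a - n < 0)] at h
    have : ((n : ℝ) + 2) * (n + 1) ≤ |Ring.choose a (n + 1)| * (n + 1) := by
      rw [h]; nlinarith
    push_cast
    linarith [le_of_mul_le_mul_right this (by positivity)]

theorem hasSum_binomial {x : ℝ} (hx : |x| < 1) (a : ℝ) :
    HasSum (fun n => Ring.choose a n * x ^ n) ((1 + x) ^ a) := by
  have h := (one_add_rpow_hasFPowerSeriesOnBall_zero (a := a)).hasSum (y := x)
    (by simpa [Metric.mem_eball, edist_dist, Real.dist_eq] using hx)
  refine (by simpa only [zero_add] using h : HasSum _ ((1 + x) ^ a)).congr_fun fun n => ?_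
  rw [binomialSeries_apply]
  simp

theorem summable_abs_binomial {x : ℝ} (hx : |x| < 1) (a : ℝ) :
    Summable fun n => |Ring.choose a n| * |x| ^ n := by
  simpa [abs_mul] using (hasSum_binomial hx a).summable.abs

theorem hasSum_binomial_even {x : ℝ} (hx : |x| < 1) (a : ℝ) :
    HasSum (fun m => Ring.choose a (2 * m) * x ^ (2 * m)) (((1 + x) ^ a + (1 - x) ^ a) / 2) := by
  have h := ((hasSum_binomial hx a).add
    (hasSum_binomial (x := -x) (by rwa [abs_neg]) a)).div_const 2
  rw [← (mul_right_injective₀ (two_ne_zero (α := ℕ))).hasSum_iff] at h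
  · refine h.congr_fun fun m => ?_
    simp only [Function.comp_apply, (even_two_mul m).neg_pow]
    ring
  · intro n hn
    have hodd : Odd n := by
      rw [← Nat.not_even_iff_odd]
      rintro ⟨m, rfl⟩
      exact hn ⟨m, two_mul m⟩
    simp [hodd.neg_pow]

/-! ### Beta values and cosine moments. -/

theorem beta_half_succ (p : ℕ) :
    ProbabilityTheory.beta ((p : ℝ) + 1 + 1 / 2) (1 / 2) * (2 * p + 2)
      = (2 * p + 1) * ProbabilityTheory.beta ((p : ℝ) + 1 / 2) (1 / 2) := by
  have h1 : Gamma ((p : ℝ) + 1 + 1 / 2) = (p + 1 / 2) * Gamma (p + 1 / 2) := by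
    rw [← Gamma_add_one (by positivity)]; ring_nf
  have h2 : Gamma ((p : ℝ) + 1 + 1 / 2 + 1 / 2) = (p + 1) * Gamma (p + 1) := by
    rw [← Gamma_add_one (by positivity)]; ring_nf
  have h3 : (p : ℝ) + 1 / 2 + 1 / 2 = p + 1 := by ring
  have h4 : 0 < Gamma ((p : ℝ) + 1) := Gamma_pos_of_pos (by positivity)
  simp only [ProbabilityTheory.beta, h1, h2, h3]
  field_simp

theorem beta_half_half : ProbabilityTheory.beta (1 / 2) (1 / 2) = π := by
  rw [ProbabilityTheory.beta, Gamma_one_half_eq, add_halves, Gamma_one, div_one,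
    mul_self_sqrt pi_pos.le]

/-- By `beta_half_succ` the right-hand side increases with `p`, and it equals `π` at `p = 0`. -/
theorem le_beta_half (p : ℕ) :
    π ≤ (2 * p + 1) * ProbabilityTheory.beta ((p : ℝ) + 1 / 2) (1 / 2) := by
  induction p with
  | zero => simp [-one_div, beta_half_half]
  | succ p ih =>
    have h := beta_half_succ p
    have hb := ProbabilityTheory.beta_pos (α := (p : ℝ) + 1 + 1 / 2) (β := 1 / 2)
      (by positivity) (by norm_num)
    push_cast
    linarith

theorem integral_cos_pow_even_two_pi (p : ℕ) :
    ∫ θ in (0 : ℝ)..(2 * π), cos θ ^ (2 * p)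
      = 2 * ProbabilityTheory.beta ((p : ℝ) + 1 / 2) (1 / 2) := by
  induction p with
  | zero => simp [-one_div, beta_half_half]
  | succ p ih =>
    have h := beta_half_succ p
    rw [mul_add_one, integral_cos_pow, ih, sin_two_pi, sin_zero]
    push_cast
    rw [mul_zero, mul_zero, sub_zero, zero_div, zero_add, div_mul_eq_mul_div,
      div_eq_iff (by positivity)]
    linarith

/-! ### Expansion of the period integral. -/

theorem hasSum_intervalIntegral_of_bounded {F : ℕ → ℝ → ℝ} {f : ℝ → ℝ} {b : ℕ → ℝ} (x y : ℝ)
    (hF : ∀ n, Continuous (F n)) (hb : Summable b) (hFb : ∀ n t, |F n t| ≤ b n)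
    (hf : ∀ t, HasSum (fun n => F n t) (f t)) :
    HasSum (fun n => ∫ t in x..y, F n t) (∫ t in x..y, f t) :=
  intervalIntegral.hasSum_integral_of_dominated_convergence (fun n _ => b n)
    (fun n => (hF n).aestronglyMeasurable) (fun n => MeasureTheory.ae_of_all _ fun t _ => hFb n t)
    (MeasureTheory.ae_of_all _ fun _ _ => hb) intervalIntegrable_const (MeasureTheory.ae_of_all _ fun t _ => hf t)

/-- The coefficient of `choose β (2 m)` in the expansion of the period. -/
noncomputable def periodMoment (a κ : ℝ) (m : ℕ) : ℝ :=
  ∫ θ in (0 : ℝ)..(2 * π), (κ * cos θ) ^ (2 * m) * (1 + (κ * cos θ) ^ 2) ^ (a - m)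

theorem abs_mul_cos_le (κ θ : ℝ) : |κ * cos θ| ≤ |κ| := by
  rw [abs_mul]
  exact mul_le_of_le_one_right (abs_nonneg _) (abs_cos_le_one _)

theorem hasSum_periodMoment {κ : ℝ} (hκ : |κ| < 1) (a : ℝ) (m : ℕ) :
    HasSum (fun n : ℕ => Ring.choose (a - m) n * κ ^ (2 * (m + n)) *
      (2 * ProbabilityTheory.beta ((m : ℝ) + n + 1 / 2) (1 / 2))) (periodMoment a κ m) := by
  have hκ2 : |κ ^ 2| < 1 := by rw [abs_pow]; exact pow_lt_one₀ (abs_nonneg _) hκ two_ne_zero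
  have h := hasSum_intervalIntegral_of_bounded 0 (2 * π)
    (F := fun n θ => Ring.choose (a - m) n * (κ * cos θ) ^ (2 * (m + n)))
    (f := fun θ => (κ * cos θ) ^ (2 * m) * (1 + (κ * cos θ) ^ 2) ^ (a - m))
    (b := fun n => |Ring.choose (a - m) n| * |κ ^ 2| ^ n) (fun n => by fun_prop)
    (summable_abs_binomial hκ2 _) (fun n θ => ?_) fun θ => ?_
  · refine h.congr_fun fun n => ?_
    have := integral_cos_pow_even_two_pi (m + n)
    push_cast at this
    simp only [mul_pow, intervalIntegral.integral_const_mul, this]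
    ring
  · rw [abs_mul, abs_pow]
    refine mul_le_mul_of_nonneg_left ?_ (abs_nonneg _)
    calc |κ * cos θ| ^ (2 * (m + n)) ≤ |κ| ^ (2 * (m + n)) :=
          pow_le_pow_left₀ (abs_nonneg _) (abs_mul_cos_le _ _) _
      _ ≤ |κ| ^ (2 * n) := pow_le_pow_of_le_one (abs_nonneg _) hκ.le (by omega)
      _ = |κ ^ 2| ^ n := by rw [abs_pow, pow_mul]
  · have hx : |(κ * cos θ) ^ 2| < 1 := by
      rw [abs_pow]
      exact pow_lt_one₀ (abs_nonneg _) ((abs_mul_cos_le _ _).trans_lt hκ) two_ne_zero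
    refine ((hasSum_binomial hx (a - m)).mul_left ((κ * cos θ) ^ (2 * m))).congr_fun fun n => ?_
    ring

/-- The even part of the phase density, expanded. -/
theorem hasSum_phaseDensity_even (β κ θ : ℝ) :
    HasSum (fun m : ℕ => Ring.choose β (2 * m) *
        ((κ * cos θ) ^ (2 * m) * (1 + (κ * cos θ) ^ 2) ^ ((β - 1) / 2 - m)))
      ((phaseDensity β κ θ + phaseDensity β κ (θ + π)) / 2) := by
  simp only [phaseDensity, phasePosition, cos_add_pi, mul_neg, arsinh_neg, neg_sq]
  set x := κ * cos θ with hx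
  have hS2 : √(1 + x ^ 2) ^ 2 = 1 + x ^ 2 := sq_sqrt (by positivity)
  have hpos : 0 < 1 + x ^ 2 := by positivity
  have hS : 0 < √(1 + x ^ 2) := by positivity
  have hpow : ∀ s : ℝ, √(1 + x ^ 2) ^ s = (1 + x ^ 2) ^ (s / 2) := fun s => by
    rw [sqrt_eq_rpow, ← rpow_mul hpos.le]; ring_nf
  have hxS : |x| < √(1 + x ^ 2) := by
    rw [← sqrt_sq_eq_abs]; exact sqrt_lt_sqrt (sq_nonneg _) (by linarith)
  have hr : |x / √(1 + x ^ 2)| < 1 := by rw [abs_div, abs_of_pos hS]; exact (div_lt_one hS).2 hxS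
  have hlt := abs_lt.1 hr
  have h1 : exp (β * arsinh x) = √(1 + x ^ 2) ^ β * (1 + x / √(1 + x ^ 2)) ^ β := by
    rw [mul_comm, exp_mul, exp_arsinh, ← mul_rpow hS.le (by linarith)]
    congr 1; field_simp; ring
  have h2 : exp (-(β * arsinh x)) = √(1 + x ^ 2) ^ β * (1 - x / √(1 + x ^ 2)) ^ β := by
    rw [← mul_neg, ← arsinh_neg, mul_comm, exp_mul, exp_arsinh, ← mul_rpow hS.le (by linarith),
      neg_sq]
    congr 1; field_simp; ring
  rw [h1, h2]
  have h := (hasSum_binomial_even hr β).mul_left (√(1 + x ^ 2) ^ (β - 1))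
  rw [show (√(1 + x ^ 2) ^ β * (1 + x / √(1 + x ^ 2)) ^ β / √(1 + x ^ 2) +
      √(1 + x ^ 2) ^ β * (1 - x / √(1 + x ^ 2)) ^ β / √(1 + x ^ 2)) / 2
      = √(1 + x ^ 2) ^ (β - 1) * (((1 + x / √(1 + x ^ 2)) ^ β + (1 - x / √(1 + x ^ 2)) ^ β) / 2) by
    rw [rpow_sub_one hS.ne']; ring]
  refine h.congr_fun fun m => ?_
  rw [hpow, rpow_sub hpos, rpow_natCast, div_pow, pow_mul √(1 + x ^ 2), hS2]
  ring

/-- A half turn changes the sign of `cos θ`, so averaging over it removes the odd powers without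
changing the integral. -/
theorem integral_phaseDensity_eq (β κ : ℝ) :
    ∫ θ in (0 : ℝ)..(2 * π), phaseDensity β κ θ
      = ∫ θ in (0 : ℝ)..(2 * π), (phaseDensity β κ θ + phaseDensity β κ (θ + π)) / 2 := by
  have hc := continuous_phaseDensity β κ
  have hper : Function.Periodic (phaseDensity β κ) (2 * π) := fun θ => by
    simp only [phaseDensity, phasePosition, cos_add_two_pi]
  have hshift : ∫ θ in (0 : ℝ)..(2 * π), phaseDensity β κ (θ + π)
      = ∫ θ in (0 : ℝ)..(2 * π), phaseDensity β κ θ := by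
    rw [intervalIntegral.integral_comp_add_right, zero_add, add_comm,
      hper.intervalIntegral_add_eq π 0, zero_add]
  have hc' : Continuous fun θ => phaseDensity β κ (θ + π) := by fun_prop
  rw [intervalIntegral.integral_div, intervalIntegral.integral_add (hc.intervalIntegrable _ _)
    (hc'.intervalIntegrable _ _), hshift]
  ring

/-- No smallness of `κ` is needed: `|x| / √(1 + x²)` stays below `|κ| / √(1 + κ²) < 1`, which gives
a summable majorant. -/
theorem hasSum_integral_phaseDensity {β : ℝ} (hβ : 0 < β) (κ : ℝ) :
    HasSum (fun m => Ring.choose β (2 * m) * periodMoment ((β - 1) / 2) κ m)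
      (∫ θ in (0 : ℝ)..(2 * π), phaseDensity β κ θ) := by
  set M := √(1 + κ ^ 2) with hM
  have hM0 : 0 < M := by positivity
  have hρ : |(|κ| / M)| < 1 := by
    rw [abs_div, abs_abs, abs_of_pos hM0, div_lt_one hM0, ← sqrt_sq_eq_abs]
    exact sqrt_lt_sqrt (sq_nonneg _) (by linarith)
  have hb : Summable fun m => (M ^ 2) ^ (β / 2) *
      (|Ring.choose β (2 * m)| * |(|κ| / M)| ^ (2 * m)) :=
    ((summable_abs_binomial hρ β).comp_injective (mul_right_injective₀ two_ne_zero)).mul_left _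
  rw [integral_phaseDensity_eq]
  have h := hasSum_intervalIntegral_of_bounded 0 (2 * π) (fun m => ?_) hb (fun m θ => ?_)
    (hasSum_phaseDensity_even β κ)
  · simpa only [periodMoment, intervalIntegral.integral_const_mul] using h
  · have : Continuous fun θ => (1 + (κ * cos θ) ^ 2) ^ ((β - 1) / 2 - m) :=
      Continuous.rpow_const (by fun_prop) fun θ => Or.inl (by positivity)
    fun_prop
  · have hM2 : M ^ 2 = 1 + κ ^ 2 := sq_sqrt (by positivity)
    have hle : (κ * cos θ) ^ 2 ≤ κ ^ 2 := sq_le_sq.2 (abs_mul_cos_le κ θ)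
    generalize κ * cos θ = x at hle
    have hpos : 0 < 1 + x ^ 2 := by positivity
    rw [abs_mul, mul_left_comm, abs_div, abs_abs, abs_of_pos hM0, pow_mul (|κ| / M), div_pow, sq_abs,
      hM2]
    refine mul_le_mul_of_nonneg_left ?_ (abs_nonneg _)
    rw [abs_of_nonneg (by rw [pow_mul]; positivity), rpow_sub hpos, rpow_natCast, pow_mul,
      mul_div_left_comm, ← div_pow]
    -- The exponent `(β - 1) / 2` may be negative, so it is first raised to `β / 2 > 0`, where the
    -- power is monotone in its base.
    have h1 : (1 + x ^ 2) ^ ((β - 1) / 2) ≤ (1 + κ ^ 2) ^ (β / 2) :=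
      (rpow_le_rpow_of_exponent_le (by nlinarith) (by linarith)).trans
        (rpow_le_rpow hpos.le (by linarith) (by positivity))
    refine mul_le_mul h1 (pow_le_pow_left₀ (by positivity) ?_ _) (by positivity) (by positivity)
    rw [div_le_div_iff₀ hpos (by positivity)]
    nlinarith

theorem periodMoment_zero_zero (κ : ℝ) : periodMoment 0 κ 0 = 2 * π := by
  simp [periodMoment]

theorem ring_choose_one_two_mul {m : ℕ} (hm : m ≠ 0) : Ring.choose (1 : ℝ) (2 * m) = 0 := by
  rw [← Nat.cast_one (R := ℝ), Ring.choose_natCast, Nat.choose_eq_zero_of_lt (by omega),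
    Nat.cast_zero]

theorem integral_phaseDensity_one (κ : ℝ) :
    ∫ θ in (0 : ℝ)..(2 * π), phaseDensity 1 κ θ = 2 * π := by
  refine (hasSum_integral_phaseDensity one_pos κ).unique ?_
  convert hasSum_single 0 fun m hm => ?_ using 1
  · simp [periodMoment_zero_zero]
  · rw [ring_choose_one_two_mul hm, zero_mul]

/-! ### Convergence and divergence of the double series. -/

theorem amplitudeParameter_eq {c : ℝ} (hc : 0 < c) (α : ℝ) {q₀ : ℝ} (hq₀ : 0 < q₀) :
    amplitudeParameter c α q₀ = |sinh ((α + 1) / 2 * log q₀)| := by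
  have h : q₀ ^ ((α + 1) / 2) = exp ((α + 1) / 2 * log q₀) := by
    rw [rpow_def_of_pos hq₀, mul_comm]
  rw [amplitudeParameter, symmetrizedPotential_coordinate c α hq₀, isotonicPotential,
    abs_of_pos hq₀, h, ← sqrt_sq_eq_abs, sinh_eq, exp_neg]
  congr 1
  field_simp
  ring

theorem hasSum_periodTerm {α κ : ℝ} (hα : 0 < α) (h : |κ| < 1 ∨ α = 1) (m : ℕ) :
    HasSum (periodTerm α |κ| m) (Ring.choose (2 / (α + 1)) (2 * m) *
      periodMoment ((2 / (α + 1) - 1) / 2) κ m / 2) := by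
  have hexp : 1 / (α + 1) - 1 / 2 = (2 / (α + 1) - 1) / 2 := by field_simp
  have hpow : ∀ n, |κ| ^ (2 * (m + n)) = κ ^ (2 * (m + n)) := fun n => by
    rw [pow_mul, sq_abs, ← pow_mul]
  by_cases hκ : |κ| < 1
  · refine (((hasSum_periodMoment hκ ((2 / (α + 1) - 1) / 2) m).mul_left
      (Ring.choose (2 / (α + 1)) (2 * m))).div_const 2).congr_fun fun n => ?_
    rw [periodTerm, hpow, hexp]
    ring
  · obtain rfl := h.resolve_left hκ
    have h1 : (2 : ℝ) / (1 + 1) = 1 := by norm_num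
    rcases Nat.eq_zero_or_pos m with rfl | hm
    · rw [h1, sub_self, zero_div, periodMoment_zero_zero]
      convert hasSum_single 0 fun n hn => ?_ using 1
      · simp [periodTerm, -one_div, beta_half_half]
      · rw [periodTerm, show (1 : ℝ) / (1 + 1) - 1 / 2 - (0 : ℕ) = 0 by norm_num,
          Ring.choose_zero_pos ℝ (Nat.pos_of_ne_zero hn)]
        simp
    · have h0 : Ring.choose ((2 : ℝ) / (1 + 1)) (2 * m) = 0 := by
        rw [h1, ring_choose_one_two_mul hm.ne']
      have : periodTerm 1 |κ| m = fun _ => 0 := by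
        funext n; simp only [periodTerm, h0, zero_mul]
      rw [this, h0, zero_mul, zero_div]
      exact hasSum_zero

/-- The choice `m = 3` puts the upper argument of the inner binomial below `-2`, so its growth `n +
1` offsets the Beta decay `π / (2 n + 7)`. -/
theorem not_tendsto_sum_periodTerm {α k : ℝ} (hα : 0 < α) (hα1 : α ≠ 1) (hk : 1 ≤ k) (s : ℝ) :
    ¬ Tendsto (fun N : ℕ => ∑ n ∈ Finset.range N, periodTerm α k 3 n) atTop (𝓝 s) := by
  intro h
  have h0 : Tendsto (fun n => |periodTerm α k 3 n|) atTop (𝓝 0) := by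
    have := ((h.comp (tendsto_add_atTop_nat 1)).sub h).abs
    simpa [Finset.sum_range_succ] using this
  have hβ0 : 0 < 2 / (α + 1) := by positivity
  have hβ2 : 2 / (α + 1) < 2 := by rw [div_lt_iff₀ (by positivity)]; linarith
  have hβ1 : 2 / (α + 1) ≠ 1 := by
    rw [Ne, div_eq_one_iff_eq (by positivity)]; exact fun h => hα1 (by linarith)
  -- `2 / (α + 1)` lies in `(0, 2)` and differs from `1`, so it is not a natural number.
  have hne : Ring.choose (2 / (α + 1)) (2 * 3) ≠ 0 := Ring.choose_ne_zero_of_forall_ne (fun n hn => by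
    rcases n with _ | _ | n
    · simp [hn] at hβ0
    · simp [hn] at hβ1
    · rw [hn] at hβ2; push_cast at hβ2; linarith [(n.cast_nonneg : (0 : ℝ) ≤ n)]) _
  have hexp : 1 / (α + 1) = 2 / (α + 1) / 2 := by field_simp
  have hlow : ∀ n : ℕ, |Ring.choose (2 / (α + 1)) (2 * 3)| * (π / 7) ≤ |periodTerm α k 3 n| := by
    intro n
    have h1 := le_abs_ring_choose (a := 1 / (α + 1) - 1 / 2 - ((3 : ℕ) : ℝ))
      (by push_cast; linarith) n
    have h2 := le_beta_half (3 + n)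
    push_cast at h2
    have hb : 0 < ProbabilityTheory.beta ((3 : ℝ) + n + 1 / 2) (1 / 2) :=
      ProbabilityTheory.beta_pos (by positivity) (by norm_num)
    have h3 : 1 ≤ |k ^ (2 * (3 + n))| := (one_le_pow₀ hk).trans (le_abs_self _)
    rw [periodTerm, abs_mul, abs_mul, abs_mul, mul_assoc, mul_assoc]
    refine mul_le_mul_of_nonneg_left ?_ (abs_nonneg _)
    push_cast at h1 ⊢
    rw [abs_of_pos hb]
    have hn : (0 : ℝ) ≤ n := n.cast_nonneg
    calc π / 7 ≤ ((n : ℝ) + 1) * (1 * ProbabilityTheory.beta ((3 : ℝ) + n + 1 / 2) (1 / 2)) := by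
          nlinarith
      _ ≤ _ := by gcongr
  have := ge_of_tendsto h0 (Eventually.of_forall hlow)
  have hp : 0 < |Ring.choose (2 / (α + 1)) (2 * 3)| * (π / 7) := by positivity
  linarith

theorem theorem1p1 (α c q₀ : ℝ) (hα : 0 < α) (hc : 0 < c) (hq₀ : 0 < q₀) (hne : q₀ ≠ 1) :
    -- the equation of motion is the one governed by the potential
    (∀ q : ℝ, 0 < q → HasDerivAt (isotonicPotential c α)
      (c / 8 * (α + 1) * q ^ α - c * (α + 1) / (8 * q ^ (α + 2))) q) ∧
    -- the motion exists, is unique, and has a period, given by the double series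
    (∃! q : ℝ → ℝ, IsIsotonicMotion c α q₀ q) ∧
    (∀ q : ℝ → ℝ, IsIsotonicMotion c α q₀ q →
      ∃ T : ℝ, IsMinimalPeriod q T ∧
        (amplitudeParameter c α q₀ < 1 ∨ α = 1 →
          (∀ m, Summable (periodTerm α (amplitudeParameter c α q₀) m)) ∧
          Summable (fun m => ∑' n, periodTerm α (amplitudeParameter c α q₀) m n) ∧
          T = 4 / (√c * (α + 1)) *
            ∑' m, ∑' n, periodTerm α (amplitudeParameter c α q₀) m n) ∧
        (α = 1 → T = 2 * Real.pi / √c)) ∧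
    -- the double series makes sense in no other case, even if its inner sums are only
    -- required to converge conditionally
    ((∀ m, ∃ s : ℝ, Filter.Tendsto
        (fun N : ℕ => ∑ n ∈ Finset.range N, periodTerm α (amplitudeParameter c α q₀) m n)
        Filter.atTop (nhds s)) →
      amplitudeParameter c α q₀ < 1 ∨ α = 1) := by
  rw [amplitudeParameter_eq hc α hq₀]
  obtain ⟨q, hq, hT⟩ := exists_isotonicMotion hα hc hq₀ hne
  set κ := sinh ((α + 1) / 2 * log q₀) with hκ
  have hβ : 0 < 2 / (α + 1) := by positivity
  -- A cosine moment over a full turn is twice a Beta value; this `2` turns the factor `2 / (√c (α +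
  -- 1))` into `4 / (√c (α + 1))`.
  have hsum := (hasSum_integral_phaseDensity hβ κ).div_const 2
  rw [intervalIntegral.integral_const_mul] at hT
  refine ⟨fun q hq => hasDerivAt_isotonicPotential c α hq, ⟨q, hq, fun p hp => hp.unique hα hc hq⟩,
    fun p hp => ⟨_, hp.unique hα hc hq ▸ hT, fun h => ?_, ?_⟩, fun h => ?_⟩
  · have hin := hasSum_periodTerm hα h
    have hfun : (fun m => ∑' n, periodTerm α |κ| m n) = fun m => Ring.choose (2 / (α + 1)) (2 * m) *
        periodMoment ((2 / (α + 1) - 1) / 2) κ m / 2 := funext fun m => (hin m).tsum_eq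
    refine ⟨fun m => (hin m).summable, ?_, ?_⟩
    · rw [hfun]; exact hsum.summable
    · rw [hfun, hsum.tsum_eq]; ring
  · rintro rfl
    rw [show (2 : ℝ) / (1 + 1) = 1 by norm_num, integral_phaseDensity_one]
    field_simp
    norm_num
  · by_contra! hcon
    obtain ⟨s, hs⟩ := h 3
    exact not_tendsto_sum_periodTerm hα hcon.2 hcon.1 s hs
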